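/- An arithmetic circuit over $\mathbb{R}$ in a finite set of variables is a finite directed acyclic graph (parallel edges allowed) with exactly one node of in-degree zero, called the root, whose nodes are sum nodes with real-weighted edges to their children, product nodes with unweighted edges to their children, and leaves labelled by a variable or a real constant. Each node represents a polynomial: a leaf represents its label, a sum node the weighted sum of the polynomials represented by its children, and a product node the product of the polynomials represented by its children. The circuit computes the polynomial represented by its root (as an element of the polynomial ring), and its size is its number of edges. No decomposability or other structural assumption is made on circuits, and the weights and constants are arbitrary real numbers. Let $\Pr:\{0,1\}^n\to\mathbb{R}$ be the mass function of a probability distribution on $n$ binary random variables. For $S\subseteq[n]=\{1,\dots,n\}$ let $\boldsymbol{x}_S\in\{0,1\}^n$ be the assignment that is $1$ exactly at the indices in $S$. The generating polynomial of $\Pr$ is $$g(x_1,\dots,x_n)=\sum_{S\subseteq[n]}\Pr(\boldsymbol{x}_S)\prod_{i\in S}x_i ,$$ and its network polynomial is $$p(x_1,\dots,x_n,\bar x_1,\dots,\bar x_n)=\sum_{S\subseteq[n]}\Pr(\boldsymbol{x}_S)\prod_{i\in S}x_i\prod_{i\notin S}\bar x_i .$$ **Theorem.** A circuit of size $s$ computing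 the generating polynomial of $\Pr$ can be transformed into a circuit of size $O(sn^2)$ computing the network polynomial of $\Pr$ (where, for a circuit consisting of a single leaf, $s=0$ is replaced by $1$ in the bound). Precisely: there is an absolute constant $K$ such that for every $n\ge 0$, every probability mass function $\Pr$ on $\{0,1\}^n$ and every arithmetic circuit of size $s$ in the variables $x_1,\dots,x_n$ that computes $g$, there is an arithmetic circuit of size at most $K\cdot\max(s,1)\cdot n^2$ in the variables $x_1,\dots,x_n,\bar x_1,\dots,\bar x_n$ that computes $p$. -/

import Mathlib

/-- The label of a node of an arithmetic circuit with variables indexed by `σ` and nodes `V`.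
A sum node carries a list of weighted edges to its children, a product node a list of unweighted
edges to its children (parallel edges are allowed, and each of them counts as an edge).
The order of the lists plays no role. -/
inductive CircuitNode (σ V : Type) : Type
  | var (i : σ)
  | const (c : ℝ)
  | sum (edges : List (ℝ × V))
  | prod (edges : List V)

namespace CircuitNode

variable {σ V : Type}

/-- The endpoints of the outgoing edges, one entry for each edge. -/
def children : CircuitNode σ V → List V
  | var _ => []
  | const _ => []
  | sum edges => edges.map Prod.snd
  | prod edges => edges

/-- The polynomial represented by a node whose children represent the polynomials `f`. -/
noncomputable def value (f : V → MvPolynomial σ ℝ) : CircuitNode σ V → MvPolynomial σ ℝ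
  | var i => MvPolynomial.X i
  | const c => MvPolynomial.C c
  | sum edges => (edges.map fun e => MvPolynomial.C e.1 * f e.2).sum
  | prod edges => (edges.map f).prod

theorem value_congr {f g : V → MvPolynomial σ ℝ} (a : CircuitNode σ V)
    (h : ∀ u ∈ a.children, f u = g u) : a.value f = a.value g := by
  cases a with
  | var i => rfl
  | const c => rfl
  | sum edges =>
    simp only [value]
    refine congrArg List.sum (List.map_congr_left fun e he => ?_)
    rw [h e.2 (List.mem_map_of_mem he)]
  | prod edges =>
    simp only [value]
    exact congrArg List.prod (List.map_congr_left fun e he => h e he)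

end CircuitNode

/-- An arithmetic circuit over `ℝ` in variables indexed by `σ`: a finite directed acyclic graph of
sum nodes, product nodes and leaves, with exactly one node of in-degree zero, the root. -/
structure ArithCircuit (σ : Type) : Type 1 where
  Node : Type
  fintypeNode : Fintype Node
  label : Node → CircuitNode σ Node
  /-- There is no directed cycle. -/
  acyclic : ∀ v, ¬ Relation.TransGen (fun u w => u ∈ (label w).children) v v
  root : Node
  /-- The root is the one and only node that is not a child of any node. -/
  inDegree_zero_iff : ∀ v, (∀ w, v ∉ (label w).children) ↔ v = root

namespace ArithCircuit

variable {σ : Type}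

/-- `Φ.IsChild u w`: there is an edge from `w` to its child `u`. -/
def IsChild (Φ : ArithCircuit σ) (u w : Φ.Node) : Prop :=
  u ∈ (Φ.label w).children

theorem wellFounded_isChild (Φ : ArithCircuit σ) : WellFounded Φ.IsChild := by
  have := Φ.fintypeNode
  have : Std.Irrefl (Relation.TransGen Φ.IsChild) := ⟨Φ.acyclic⟩
  have : IsTrans Φ.Node (Relation.TransGen Φ.IsChild) := ⟨fun _ _ _ => Relation.TransGen.trans⟩
  exact Subrelation.wf (fun h => Relation.TransGen.single h)
    (Finite.wellFounded_of_trans_of_irrefl (Relation.TransGen Φ.IsChild))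

open Classical in
/-- The polynomial represented by a node, defined by recursion along the edges;
see `nodePoly_eq` for the recursion that it satisfies. -/
noncomputable def nodePoly (Φ : ArithCircuit σ) : Φ.Node → MvPolynomial σ ℝ :=
  Φ.wellFounded_isChild.fix fun v ih =>
    (Φ.label v).value fun u => if h : Φ.IsChild u v then ih u h else 0

theorem nodePoly_eq (Φ : ArithCircuit σ) (v : Φ.Node) :
    Φ.nodePoly v = (Φ.label v).value Φ.nodePoly := by
  classical
  rw [nodePoly, WellFounded.fix_eq]
  refine CircuitNode.value_congr _ fun u hu => ?_
  have h : Φ.IsChild u v := hu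
  simp only [dif_pos h]

/-- The polynomial represented (computed) by a circuit is the one represented by its root. -/
noncomputable def poly (Φ : ArithCircuit σ) : MvPolynomial σ ℝ :=
  Φ.nodePoly Φ.root

/-- The size of a circuit is its number of edges. -/
def size (Φ : ArithCircuit σ) : ℕ :=
  haveI := Φ.fintypeNode
  ∑ v : Φ.Node, (Φ.label v).children.length

end ArithCircuit

/-- The function `P : {0,1}ⁿ → ℝ` is the mass function of a probability distribution
on `n` binary random variables. -/
def IsProbabilityMass {n : ℕ} (P : (Fin n → Fin 2) → ℝ) : Prop :=
  (∀ x, 0 ≤ P x) ∧ ∑ x, P x = 1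

/-- The assignment `x_S` with `X_i = 1` for `i ∈ S` and `X_i = 0` for `i ∉ S`. -/
def assignment {n : ℕ} (S : Finset (Fin n)) : Fin n → Fin 2 :=
  fun i => if i ∈ S then 1 else 0

/-- The generating polynomial `∑_S P(x_S) ∏_{i ∈ S} x_i`. -/
noncomputable def generatingPoly {n : ℕ} (P : (Fin n → Fin 2) → ℝ) : MvPolynomial (Fin n) ℝ :=
  ∑ S : Finset (Fin n), MvPolynomial.C (P (assignment S)) * ∏ i ∈ S, MvPolynomial.X i

/-- The network polynomial `∑_S P(x_S) ∏_{i ∈ S} x_i ∏_{i ∉ S} x̄_i`; the variable `x_i` is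
`X (Sum.inl i)` and the variable `x̄_i` is `X (Sum.inr i)`. -/
noncomputable def networkPoly {n : ℕ} (P : (Fin n → Fin 2) → ℝ) :
    MvPolynomial (Fin n ⊕ Fin n) ℝ :=
  ∑ S : Finset (Fin n), MvPolynomial.C (P (assignment S)) *
    (∏ i ∈ S, MvPolynomial.X (Sum.inl i)) * ∏ i ∈ Sᶜ, MvPolynomial.X (Sum.inr i)

/-! Formally `p = (∏ x̄_i) · g(x_1 / x̄_1, …, x_n / x̄_n)`, and the divisions are removed as in
Strassen's argument. Put `y_i = 1 - x̄_i` and introduce a new variable `t`: the quotient `x_i t / (1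
- y_i t)` is a power series in `t`, and `∏ (1 - y_i t)` times `g` at these series is a polynomial in
`t` of degree at most `n` whose value at `t = 1` is `p` (`prod_mul_eval₂_generatingPoly`,
`natDegree_shiftedNetworkPoly_le`, `eval_one_shiftedNetworkPoly`). So it suffices to run the given
circuit modulo `t ^ (n + 1)`, keeping `n + 1` coefficients per node; each edge then costs `O(n²)`
(`derives_coeffsUpTo`). Clearing denominators and adding the coefficients costs another `O(n²)`.
Costs are counted for sets of polynomials closed under circuit operations (`Generated`, `Derives`);
a circuit is extracted only at the end. -/

namespace CircuitNode

variable {σ V W : Type}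

/-- Redirect the outgoing edges of a node along `f`. -/
def map (f : V → W) : CircuitNode σ V → CircuitNode σ W
  | var i => var i
  | const c => const c
  | sum edges => sum (edges.map fun e => (e.1, f e.2))
  | prod edges => prod (edges.map f)

theorem children_map (f : V → W) (a : CircuitNode σ V) :
    (a.map f).children = a.children.map f := by
  cases a <;> simp [map, children]

theorem value_map (f : V → W) (g : W → MvPolynomial σ ℝ) (a : CircuitNode σ V) :
    (a.map f).value g = a.value fun v => g (f v) := by
  cases a <;> simp [map, value, Function.comp_def]

end CircuitNode

/-! ### Derivations of polynomials, with edge counts. -/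

section Derivation

variable {τ : Type}

/-- The polynomials in `B` are represented by the nodes of a directed acyclic graph with at most
`c` edges; the nodes are the polynomials themselves. -/
def Generated (B : Finset (MvPolynomial τ ℝ)) (c : ℕ) : Prop :=
  ∃ (label : MvPolynomial τ ℝ → CircuitNode τ (MvPolynomial τ ℝ)) (rank : MvPolynomial τ ℝ → ℕ),
    (∀ p ∈ B, (label p).value id = p ∧ ∀ q ∈ (label p).children, q ∈ B ∧ rank q < rank p) ∧
    ∑ p ∈ B, (label p).children.length ≤ c

theorem Generated.empty : Generated (∅ : Finset (MvPolynomial τ ℝ)) 0 :=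
  ⟨fun _ => .const 0, fun _ => 0, by simp, by simp⟩

theorem Generated.mono {B : Finset (MvPolynomial τ ℝ)} {c d : ℕ} (h : Generated B c)
    (hcd : c ≤ d) : Generated B d := by
  obtain ⟨l, r, h₁, h₂⟩ := h
  exact ⟨l, r, h₁, h₂.trans hcd⟩

-- A polynomial already present keeps its old node, so no cycle can arise; a new one is ranked above
-- everything in `B`.
open Classical in
theorem Generated.insert {B : Finset (MvPolynomial τ ℝ)} {c : ℕ} (h : Generated B c)
    (a : CircuitNode τ (MvPolynomial τ ℝ)) (ha : ∀ q ∈ a.children, q ∈ B) :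
    Generated (insert (a.value id) B) (c + a.children.length) := by
  by_cases hp : a.value id ∈ B
  · rw [Finset.insert_eq_of_mem hp]
    exact h.mono (Nat.le_add_right _ _)
  obtain ⟨l, r, h₁, h₂⟩ := h
  have hne : ∀ q ∈ B, q ≠ a.value id := fun q hq e => hp (e ▸ hq)
  refine ⟨Function.update l (a.value id) a, Function.update r (a.value id) (B.sup r + 1), ?_, ?_⟩
  · intro p hpB
    rcases Finset.mem_insert.1 hpB with rfl | hpB
    · simp only [Function.update_self, true_and]
      intro q hq
      refine ⟨Finset.mem_insert_of_mem (ha q hq), ?_⟩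
      rw [Function.update_of_ne (hne q (ha q hq))]
      exact Nat.lt_succ_of_le (Finset.le_sup (ha q hq))
    · rw [Function.update_of_ne (hne p hpB), Function.update_of_ne (hne p hpB)]
      refine ⟨(h₁ p hpB).1, fun q hq => ?_⟩
      obtain ⟨hqB, hlt⟩ := (h₁ p hpB).2 q hq
      rw [Function.update_of_ne (hne q hqB)]
      exact ⟨Finset.mem_insert_of_mem hqB, hlt⟩
  · rw [Finset.sum_insert hp, Function.update_self, add_comm]
    refine Nat.add_le_add_right (le_trans (le_of_eq (Finset.sum_congr rfl fun q hq => ?_)) h₂) _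
    rw [Function.update_of_ne (hne q hq)]

/-- Every polynomial of a generated set is computed by a circuit, namely the part of the graph
that is reachable from it. -/
theorem Generated.exists_circuit {B : Finset (MvPolynomial τ ℝ)} {c : ℕ} (h : Generated B c)
    {p : MvPolynomial τ ℝ} (hp : p ∈ B) : ∃ Ψ : ArithCircuit τ, Ψ.poly = p ∧ Ψ.size ≤ c := by
  classical
  obtain ⟨l, r, h₁, h₂⟩ := h
  let R : MvPolynomial τ ℝ → MvPolynomial τ ℝ → Prop := fun w u => u ∈ (l w).children
  -- Discarding the nodes not reachable from `p` leaves `p` as the only node of in-degree zero.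
  let N := {q : MvPolynomial τ ℝ // q ∈ B ∧ Relation.ReflTransGen R p q}
  let : Fintype N := Fintype.ofInjective (β := {q // q ∈ B}) (fun q : N => ⟨q.1, q.2.1⟩)
    fun a b hab => Subtype.ext (congrArg (fun x => x.1) hab)
  let root : N := ⟨p, hp, .refl⟩
  -- The default value `root` is never met along an edge, by `hf`.
  let f : MvPolynomial τ ℝ → N := fun q =>
    if hq : q ∈ B ∧ Relation.ReflTransGen R p q then ⟨q, hq⟩ else root
  have hf : ∀ w : N, ∀ u ∈ (l w.1).children, (f u).1 = u := by
    intro w u hu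
    have : u ∈ B ∧ Relation.ReflTransGen R p u := ⟨((h₁ w.1 w.2.1).2 u hu).1, w.2.2.tail hu⟩
    simp only [f, dif_pos this]
  have hchild : ∀ u w : N, u ∈ ((l w.1).map f).children ↔ u.1 ∈ (l w.1).children := by
    intro u w
    rw [CircuitNode.children_map, List.mem_map]
    constructor
    · rintro ⟨q, hq, rfl⟩
      rwa [hf w q hq]
    · intro hu
      exact ⟨u.1, hu, Subtype.ext (hf w u.1 hu)⟩
  have hrank : ∀ u w : N, Relation.TransGen (fun u w : N => u ∈ ((l w.1).map f).children) u w →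
      r u.1 < r w.1 := by
    intro u w huw
    induction huw with
    | @single w h => exact ((h₁ w.1 w.2.1).2 _ ((hchild _ w).1 h)).2
    | @tail _ w _ h ih => exact ih.trans ((h₁ w.1 w.2.1).2 _ ((hchild _ w).1 h)).2
  have hle : ∀ q, Relation.ReflTransGen R p q → q ∈ B ∧ r q ≤ r p := by
    intro q hq
    induction hq with
    | refl => exact ⟨hp, le_rfl⟩
    | tail _ h ih =>
      have := (h₁ _ ih.1).2 _ h
      exact ⟨this.1, this.2.le.trans ih.2⟩
  let Ψ : ArithCircuit τ :=
    { Node := N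
      fintypeNode := inferInstance
      label := fun w => (l w.1).map f
      acyclic := fun v hv => lt_irrefl _ (hrank v v hv)
      root := root
      inDegree_zero_iff := by
        intro v
        constructor
        · intro hv
          rcases Relation.ReflTransGen.cases_tail v.2.2 with he | ⟨w, hw, hwv⟩
          · exact Subtype.ext he
          · exact absurd ((hchild v ⟨w, (hle w hw).1, hw⟩).2 hwv) (hv _)
        · rintro rfl w hw
          have := ((h₁ w.1 w.2.1).2 _ ((hchild _ _).1 hw)).2
          exact absurd (hle w.1 w.2.2).2 (not_le.2 this) }
  have hpoly : ∀ m, ∀ v : N, r v.1 < m → Ψ.nodePoly v = v.1 := by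
    intro m
    induction m with
    | zero => intro v hv; omega
    | succ m ih =>
      intro v hv
      rw [Ψ.nodePoly_eq]
      change ((l v.1).map f).value Ψ.nodePoly = v.1
      rw [CircuitNode.value_map]
      conv_rhs => rw [← (h₁ v.1 v.2.1).1]
      refine CircuitNode.value_congr _ fun u hu => ?_
      have := ((h₁ v.1 v.2.1).2 u hu).2
      rw [ih (f u) (by rw [hf v u hu]; omega), hf v u hu, id]
  refine ⟨Ψ, hpoly _ root (Nat.lt_succ_self _), le_trans ?_ h₂⟩
  have : Ψ.size = ∑ v : N, (l v.1).children.length := by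
    change ∑ v : N, ((l v.1).map f).children.length = _
    simp [CircuitNode.children_map]
  rw [this, ← Finset.sum_image (s := (Finset.univ : Finset N)) (g := fun v : N => v.1)
    (f := fun q => (l q).children.length) fun a _ b _ hab => Subtype.ext hab]
  refine Finset.sum_le_sum_of_subset fun q hq => ?_
  obtain ⟨v, -, rfl⟩ := Finset.mem_image.1 hq
  exact v.2.1

/-- The polynomials in `T` can be added to any generated set containing `A` at the cost of at most
`d` edges. -/
def Derives (A : Set (MvPolynomial τ ℝ)) (d : ℕ) (T : Set (MvPolynomial τ ℝ)) : Prop :=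
  ∀ (B : Finset (MvPolynomial τ ℝ)) (c : ℕ), A ⊆ B → Generated B c →
    ∃ B' : Finset (MvPolynomial τ ℝ), B ⊆ B' ∧ T ⊆ B' ∧ Generated B' (c + d)

namespace Derives

variable {A A' T T' U : Set (MvPolynomial τ ℝ)} {d e : ℕ}

theorem exists_circuit (h : Derives ∅ d T) {p : MvPolynomial τ ℝ} (hp : p ∈ T) :
    ∃ Ψ : ArithCircuit τ, Ψ.poly = p ∧ Ψ.size ≤ d := by
  obtain ⟨B, -, hT, hB⟩ := h ∅ 0 (by simp) Generated.empty
  rw [zero_add] at hB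
  exact hB.exists_circuit (hT hp)

theorem of_subset (h : T ⊆ A) : Derives A 0 T :=
  fun B _ hB hc => ⟨B, subset_rfl, h.trans hB, hc⟩

theorem mono (h : Derives A d T) (hA : A ⊆ A') (hd : d ≤ e) (hT : T' ⊆ T) :
    Derives A' e T' := by
  intro B c hB hc
  obtain ⟨B', h₁, h₂, h₃⟩ := h B c (hA.trans hB) hc
  exact ⟨B', h₁, hT.trans h₂, h₃.mono (by omega)⟩

/-- Costs add because a derivation may start from any generated set containing its premises, in
particular from the one left by the previous derivation. -/
theorem trans (h : Derives A d T) (h' : Derives (A ∪ T) e U) : Derives A (d + e) (T ∪ U) := by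
  intro B c hB hc
  obtain ⟨B', h₁, h₂, h₃⟩ := h B c hB hc
  obtain ⟨B'', k₁, k₂, k₃⟩ :=
    h' B' _ (Set.union_subset (hB.trans (Finset.coe_subset.2 h₁)) h₂) h₃
  exact ⟨B'', h₁.trans k₁, Set.union_subset (h₂.trans (Finset.coe_subset.2 k₁)) k₂,
    by rwa [← add_assoc]⟩

theorem biUnion {ι : Type*} (s : Finset ι) {d : ι → ℕ} {T : ι → Set (MvPolynomial τ ℝ)}
    (h : ∀ i ∈ s, Derives A (d i) (T i)) : Derives A (∑ i ∈ s, d i) (⋃ i ∈ s, T i) := by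
  classical
  induction s using Finset.induction_on with
  | empty => exact of_subset (by simp)
  | insert a s ha ih =>
    rw [Finset.sum_insert ha, Finset.set_biUnion_insert]
    exact (h a (Finset.mem_insert_self a s)).trans
      ((ih fun i hi => h i (Finset.mem_insert_of_mem hi)).mono Set.subset_union_left le_rfl
        subset_rfl)

theorem node (a : CircuitNode τ (MvPolynomial τ ℝ)) (ha : ∀ q ∈ a.children, q ∈ A) :
    Derives A a.children.length {a.value id} := by
  classical
  intro B c hB hc
  exact ⟨_, Finset.subset_insert _ _, by simp, hc.insert a fun q hq => hB (ha q hq)⟩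

theorem X (i : τ) : Derives A 0 {MvPolynomial.X i} :=
  node (.var i) (by simp [CircuitNode.children])

theorem C (r : ℝ) : Derives A 0 {MvPolynomial.C r} :=
  node (.const r) (by simp [CircuitNode.children])

theorem mul {p q : MvPolynomial τ ℝ} (hp : p ∈ A) (hq : q ∈ A) : Derives A 2 {p * q} := by
  simpa [CircuitNode.value, CircuitNode.children] using
    node (.prod [p, q]) (by simp [CircuitNode.children, hp, hq])

theorem sub {p q : MvPolynomial τ ℝ} (hp : p ∈ A) (hq : q ∈ A) : Derives A 2 {p - q} := by
  simpa [CircuitNode.value, CircuitNode.children, sub_eq_add_neg] using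
    node (.sum [(1, p), (-1, q)]) (by simp [CircuitNode.children, hp, hq])

theorem list_sum (es : List (ℝ × MvPolynomial τ ℝ)) (h : ∀ e ∈ es, e.2 ∈ A) :
    Derives A es.length {(es.map fun e => MvPolynomial.C e.1 * e.2).sum} := by
  have := node (A := A) (.sum es) (by
    intro q hq
    obtain ⟨e, he, rfl⟩ := List.mem_map.1 hq
    exact h e he)
  simpa [CircuitNode.value, CircuitNode.children] using this

theorem finset_sum {ι : Type*} (s : Finset ι) (f : ι → MvPolynomial τ ℝ) (h : ∀ i ∈ s, f i ∈ A) :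
    Derives A s.card {∑ i ∈ s, f i} := by
  have := list_sum (A := A) (s.toList.map fun i => ((1 : ℝ), f i)) (by
    intro e he
    obtain ⟨i, hi, rfl⟩ := List.mem_map.1 he
    exact h i (Finset.mem_toList.1 hi))
  simpa [Function.comp_def, Finset.sum_map_toList] using this

end Derives

/-! ### Arithmetic of truncated power series. -/

/-- The coefficients of degree at most `n` of a power series. -/
def coeffsUpTo {R : Type*} [Semiring R] (n : ℕ) (F : PowerSeries R) : Set R :=
  ⋃ k ∈ Finset.range (n + 1), {PowerSeries.coeff k F}

theorem coeff_mem_coeffsUpTo {R : Type*} [Semiring R] {n k : ℕ} (F : PowerSeries R) (hk : k ≤ n) :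
    PowerSeries.coeff k F ∈ coeffsUpTo n F :=
  Set.mem_biUnion (Finset.mem_coe.2 (Finset.mem_range.2 (Nat.lt_succ_of_le hk))) rfl

namespace Derives

variable {A : Set (MvPolynomial τ ℝ)} {n d : ℕ}

theorem coeffsUpTo {F : PowerSeries (MvPolynomial τ ℝ)}
    (h : ∀ k ≤ n, Derives A d {PowerSeries.coeff k F}) :
    Derives A ((n + 1) * d) (coeffsUpTo n F) := by
  have := biUnion (Finset.range (n + 1)) (d := fun _ => d) fun k hk =>
    h k (Nat.lt_succ_iff.1 (Finset.mem_range.1 hk))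
  simpa [_root_.coeffsUpTo] using this

theorem coeffsUpTo_C (r : ℝ) :
    Derives A 0 (_root_.coeffsUpTo n (PowerSeries.C (MvPolynomial.C r : MvPolynomial τ ℝ))) := by
  refine coeffsUpTo (d := 0) fun k _ => ?_
  rw [PowerSeries.coeff_C]
  split_ifs
  · exact C r
  · simpa using C (A := A) 0

/-- All `(n + 1) ^ 2` products of two coefficients cost two edges each; each of the `n + 1`
convolution sums then has at most `n + 1` terms. -/
theorem coeffsUpTo_mul {F G : PowerSeries (MvPolynomial τ ℝ)} (hF : _root_.coeffsUpTo n F ⊆ A)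
    (hG : _root_.coeffsUpTo n G ⊆ A) :
    Derives A (3 * (n + 1) ^ 2) (_root_.coeffsUpTo n (F * G)) := by
  have h₁ := biUnion (A := A) (Finset.range (n + 1) ×ˢ Finset.range (n + 1)) (d := fun _ => 2)
    (T := fun x => {PowerSeries.coeff x.1 F * PowerSeries.coeff x.2 G}) fun x hx => by
      simp only [Finset.mem_product, Finset.mem_range, Nat.lt_succ_iff] at hx
      exact mul (hF (coeff_mem_coeffsUpTo F hx.1)) (hG (coeff_mem_coeffsUpTo G hx.2))
  refine (h₁.trans (coeffsUpTo (n := n) (F := F * G) (d := n + 1) fun k hk => ?_)).mono subset_rfl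
    ?_ Set.subset_union_right
  · rw [PowerSeries.coeff_mul]
    refine (finset_sum (Finset.HasAntidiagonal.antidiagonal k) _ fun x hx => Or.inr ?_).mono
      subset_rfl (by simpa using hk) subset_rfl
    have := Finset.HasAntidiagonal.mem_antidiagonal.1 hx
    refine Set.mem_biUnion (x := x) ?_ rfl
    simp only [Finset.coe_product, Set.mem_prod, Finset.mem_coe, Finset.mem_range]
    omega
  · simp only [Finset.sum_const, Finset.card_product, Finset.card_range, smul_eq_mul]
    exact le_of_eq (by ring)

/-- Multiplying the factors one at a time, starting from `1`, charges one truncated product to each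
edge of a product node. -/
theorem coeffsUpTo_list_prod {ι : Type*} {F : ι → PowerSeries (MvPolynomial τ ℝ)} (us : List ι)
    (h : ∀ u ∈ us, _root_.coeffsUpTo n (F u) ⊆ A) :
    Derives A (us.length * (3 * (n + 1) ^ 2)) (_root_.coeffsUpTo n (us.map F).prod) := by
  induction us with
  | nil => simpa using coeffsUpTo_C (A := A) (n := n) 1
  | cons u us ih =>
    rw [List.map_cons, List.prod_cons]
    refine ((ih fun v hv => h v (List.mem_cons_of_mem u hv)).trans
      (coeffsUpTo_mul ?_ Set.subset_union_right)).mono subset_rfl ?_ Set.subset_union_right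
    · exact (h u List.mem_cons_self).trans Set.subset_union_left
    · exact le_of_eq (by rw [List.length_cons]; ring)

theorem coeffsUpTo_list_sum {ι : Type*} {F : ι → PowerSeries (MvPolynomial τ ℝ)}
    (es : List (ℝ × ι)) (h : ∀ e ∈ es, _root_.coeffsUpTo n (F e.2) ⊆ A) :
    Derives A ((n + 1) * es.length) (_root_.coeffsUpTo n
      (es.map fun e => PowerSeries.C (MvPolynomial.C e.1) * F e.2).sum) := by
  refine coeffsUpTo fun k hk => ?_
  have := list_sum (A := A) (es.map fun e => (e.1, PowerSeries.coeff k (F e.2))) (by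
    intro e he
    obtain ⟨e', he', rfl⟩ := List.mem_map.1 he
    exact h e' he' (coeff_mem_coeffsUpTo _ hk))
  simpa [map_list_sum, Function.comp_def] using this

/-- Multiplication by `1 - y t`. -/
theorem coeffsUpTo_one_sub_mul {F : PowerSeries (MvPolynomial τ ℝ)} {y : MvPolynomial τ ℝ}
    (hy : y ∈ A) (hF : _root_.coeffsUpTo n F ⊆ A) :
    Derives A ((n + 1) * 4)
      (_root_.coeffsUpTo n ((1 - PowerSeries.C y * PowerSeries.X) * F)) := by
  refine coeffsUpTo fun k hk => ?_
  cases k with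
  | zero =>
    refine (of_subset ?_).mono subset_rfl (Nat.zero_le _) subset_rfl
    simpa [sub_mul, mul_assoc] using hF (coeff_mem_coeffsUpTo F hk)
  | succ k =>
    have : PowerSeries.coeff (k + 1) ((1 - PowerSeries.C y * PowerSeries.X) * F) =
        PowerSeries.coeff (k + 1) F - y * PowerSeries.coeff k F := by
      rw [sub_mul, one_mul, mul_assoc, map_sub, PowerSeries.coeff_C_mul,
        PowerSeries.coeff_succ_X_mul]
    rw [this]
    exact ((mul hy (hF (coeff_mem_coeffsUpTo F (Nat.le_of_succ_le hk)))).trans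
      (sub (Or.inl (hF (coeff_mem_coeffsUpTo F hk))) (Or.inr rfl))).mono subset_rfl le_rfl
      Set.subset_union_right

theorem coeffsUpTo_prod_one_sub_mul {ι : Type*} {F : PowerSeries (MvPolynomial τ ℝ)}
    {y : ι → MvPolynomial τ ℝ} (s : Finset ι) (hy : ∀ i ∈ s, y i ∈ A)
    (hF : _root_.coeffsUpTo n F ⊆ A) :
    Derives A (s.card * ((n + 1) * 4))
      (_root_.coeffsUpTo n ((∏ i ∈ s, (1 - PowerSeries.C (y i) * PowerSeries.X)) * F)) := by
  classical
  induction s using Finset.induction_on with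
  | empty => simpa using of_subset hF
  | insert a s ha ih =>
    rw [Finset.prod_insert ha, mul_assoc, Finset.card_insert_of_notMem ha]
    refine ((ih fun i hi => hy i (Finset.mem_insert_of_mem hi)).trans (coeffsUpTo_one_sub_mul
      (Or.inl (hy a (Finset.mem_insert_self a s))) Set.subset_union_right)).mono subset_rfl ?_
      Set.subset_union_right
    exact le_of_eq (by ring)

end Derives

/-- The power series `x t / (1 - y t)`. -/
noncomputable def mulGeomSeries {R : Type*} [Semiring R] (x y : R) : PowerSeries R :=
  PowerSeries.X * PowerSeries.mk fun k => x * y ^ k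

theorem one_sub_mul_mulGeomSeries {R : Type*} [CommRing R] (x y : R) :
    (1 - PowerSeries.C y * PowerSeries.X) * mulGeomSeries x y =
      PowerSeries.C x * PowerSeries.X := by
  have h : (1 - PowerSeries.C y * PowerSeries.X) * PowerSeries.mk (fun k => x * y ^ k) =
      PowerSeries.C x := by
    ext k
    rw [sub_mul, one_mul, mul_assoc, map_sub, PowerSeries.coeff_C_mul, PowerSeries.coeff_C]
    cases k with
    | zero => simp
    | succ k =>
      rw [PowerSeries.coeff_succ_X_mul, PowerSeries.coeff_mk, PowerSeries.coeff_mk,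
        if_neg (Nat.succ_ne_zero k)]
      ring
  rw [mulGeomSeries, mul_left_comm, h, mul_comm]

/-- Each coefficient `x * y ^ k` with `k ≥ 1` is the previous one times `y`, hence a single product
node. -/
theorem Derives.coeffsUpTo_mulGeomSeries {A : Set (MvPolynomial τ ℝ)} {x y : MvPolynomial τ ℝ}
    (hx : x ∈ A) (hy : y ∈ A) (n : ℕ) :
    Derives A (n * 2) (_root_.coeffsUpTo n (mulGeomSeries x y)) := by
  have hcoeff : ∀ k, PowerSeries.coeff (k + 1) (mulGeomSeries x y) = x * y ^ k := fun k => by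
    rw [mulGeomSeries, PowerSeries.coeff_succ_X_mul, PowerSeries.coeff_mk]
  induction n with
  | zero => simpa [_root_.coeffsUpTo, mulGeomSeries] using C (A := A) 0
  | succ n ih =>
    have key : Derives (A ∪ _root_.coeffsUpTo n (mulGeomSeries x y)) 2
        {PowerSeries.coeff (n + 1) (mulGeomSeries x y)} := by
      cases n with
      | zero =>
        refine (of_subset ?_).mono subset_rfl (Nat.zero_le _) subset_rfl
        rw [hcoeff, pow_zero, mul_one]
        exact Set.singleton_subset_iff.2 (Or.inl hx)
      | succ n =>
        rw [hcoeff, pow_succ, ← mul_assoc, ← hcoeff]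
        exact mul (Or.inr (coeff_mem_coeffsUpTo _ le_rfl)) (Or.inl hy)
    refine (ih.trans key).mono subset_rfl (le_of_eq (by ring)) ?_
    rw [_root_.coeffsUpTo, Finset.range_add_one, Finset.set_biUnion_insert, Set.union_comm]
    rfl

end Derivation

/-! ### Evaluation of a circuit on truncated power series. -/

namespace ArithCircuit

variable {σ τ : Type}

/-- A circuit can be evaluated on power series modulo `t ^ (n + 1)`. -/
theorem derives_coeffsUpTo (Φ : ArithCircuit σ) (n : ℕ)
    (z : σ → PowerSeries (MvPolynomial τ ℝ)) :
    Derives (⋃ i, coeffsUpTo n (z i)) (Φ.size * (3 * (n + 1) ^ 2))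
      (coeffsUpTo n (MvPolynomial.eval₂ (PowerSeries.C.comp MvPolynomial.C) z Φ.poly)) := by
  classical
  let := Φ.fintypeNode
  set ev := MvPolynomial.eval₂Hom
    ((PowerSeries.C : MvPolynomial τ ℝ →+* _).comp MvPolynomial.C) z with hev
  -- The number of proper descendants increases strictly from child to parent, so it orders the
  -- nodes bottom-up.
  let r : Φ.Node → ℕ := fun v => (Finset.univ.filter fun u => Relation.TransGen Φ.IsChild u v).card
  have hr : ∀ u w, Φ.IsChild u w → r u < r w := by
    intro u w huw
    refine Finset.card_lt_card (Finset.ssubset_iff_of_subset ?_ |>.2 ⟨u, ?_, ?_⟩)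
    · intro x hx
      simp only [Finset.mem_filter, Finset.mem_univ, true_and] at hx ⊢
      exact hx.tail huw
    · simpa using Relation.TransGen.single huw
    · simpa using (show ¬ Relation.TransGen Φ.IsChild u u from Φ.acyclic u)
  have step : ∀ (A : Set (MvPolynomial τ ℝ)) (v : Φ.Node), (∀ i, coeffsUpTo n (z i) ⊆ A) →
      (∀ u, Φ.IsChild u v → coeffsUpTo n (ev (Φ.nodePoly u)) ⊆ A) →
      Derives A ((Φ.label v).children.length * (3 * (n + 1) ^ 2))
        (coeffsUpTo n (ev (Φ.nodePoly v))) := by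
    intro A v hz hu
    rw [Φ.nodePoly_eq]
    have hu' : ∀ u ∈ (Φ.label v).children, coeffsUpTo n (ev (Φ.nodePoly u)) ⊆ A := hu
    generalize Φ.label v = a at hu' ⊢
    cases a with
    | var i =>
      refine (Derives.of_subset ?_).mono subset_rfl (Nat.zero_le _) subset_rfl
      simpa [CircuitNode.value, hev] using hz i
    | const c =>
      refine (Derives.coeffsUpTo_C (n := n) c).mono subset_rfl (Nat.zero_le _) ?_
      simp [CircuitNode.value, hev]
    | sum es =>
      have := Derives.coeffsUpTo_list_sum (A := A) (n := n) (F := fun u => ev (Φ.nodePoly u)) es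
        fun e he => hu' e.2 (List.mem_map_of_mem he)
      refine this.mono subset_rfl ?_ ?_
      · simp only [CircuitNode.children, List.length_map]
        rw [mul_comm]
        exact Nat.mul_le_mul_left _ (by nlinarith)
      · simp [CircuitNode.value, hev, map_list_sum, Function.comp_def]
    | prod us =>
      have := Derives.coeffsUpTo_list_prod (A := A) (n := n)
        (F := fun u => ev (Φ.nodePoly u)) us hu'
      refine this.mono subset_rfl le_rfl ?_
      simp only [CircuitNode.value, map_list_prod, List.map_map, Function.comp_def]
      exact subset_rfl
  -- Induction over sets closed under children: a node of maximal rank is a child of no other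
  -- member, so removing it keeps the set closed.
  have all : ∀ s : Finset Φ.Node, (∀ w ∈ s, ∀ u, Φ.IsChild u w → u ∈ s) →
      Derives (⋃ i, coeffsUpTo n (z i))
        ((∑ v ∈ s, (Φ.label v).children.length) * (3 * (n + 1) ^ 2))
        (⋃ v ∈ s, coeffsUpTo n (ev (Φ.nodePoly v))) := by
    intro s
    induction s using Finset.induction_on_max_value r with
    | empty => simpa using Derives.of_subset (Set.empty_subset _)
    | insert a s ha hmax ih =>
      intro hs
      rw [Finset.sum_insert ha, Finset.set_biUnion_insert, add_mul, add_comm, Set.union_comm]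
      refine (ih fun w hw u hu => ?_).trans (step _ a ?_ ?_)
      · refine Finset.mem_of_mem_insert_of_ne (hs w (Finset.mem_insert_of_mem hw) u hu) ?_
        rintro rfl
        exact absurd (hr _ _ hu) (not_lt.2 (hmax w hw))
      · exact fun i => (Set.subset_iUnion (fun i => coeffsUpTo n (z i)) i).trans
          Set.subset_union_left
      · intro u hu
        have hus : u ∈ s := by
          refine Finset.mem_of_mem_insert_of_ne (hs a (Finset.mem_insert_self a s) u hu) ?_
          rintro rfl
          exact lt_irrefl _ (hr _ _ hu)
        exact (Set.subset_biUnion_of_mem (u := fun v => coeffsUpTo n (ev (Φ.nodePoly v)))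
          (Finset.mem_coe.2 hus)).trans Set.subset_union_right
  refine (all Finset.univ fun _ _ _ _ => Finset.mem_univ _).mono subset_rfl (le_of_eq rfl) ?_
  exact Set.subset_biUnion_of_mem (u := fun v => coeffsUpTo n (ev (Φ.nodePoly v)))
    (Finset.mem_coe.2 (Finset.mem_univ Φ.root))

end ArithCircuit

/-! ### The network polynomial as the value at `t = 1` of a polynomial in `t`. -/

section Network

open MvPolynomial

/-- `∑_S P(x_S) ∏_{i ∈ S} x_i t ∏_{i ∉ S} (1 - (1 - x̄_i) t)`. -/
noncomputable def shiftedNetworkPoly {n : ℕ} (P : (Fin n → Fin 2) → ℝ) :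
    Polynomial (MvPolynomial (Fin n ⊕ Fin n) ℝ) :=
  ∑ S : Finset (Fin n), Polynomial.C (C (P (assignment S))) *
    (∏ i ∈ S, (Polynomial.C (X (Sum.inl i)) * Polynomial.X)) *
    ∏ i ∈ Sᶜ, (1 - Polynomial.C (1 - X (Sum.inr i)) * Polynomial.X)

theorem eval_one_shiftedNetworkPoly {n : ℕ} (P : (Fin n → Fin 2) → ℝ) :
    (shiftedNetworkPoly P).eval 1 = networkPoly P := by
  simp [shiftedNetworkPoly, networkPoly, Polynomial.eval_finsetSum, Polynomial.eval_prod]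

/-- Every index contributes exactly one factor, of degree at most one in `t`. Hence truncation after
degree `n` loses nothing. -/
theorem natDegree_shiftedNetworkPoly_le {n : ℕ} (P : (Fin n → Fin 2) → ℝ) :
    (shiftedNetworkPoly P).natDegree ≤ n := by
  refine Polynomial.natDegree_sum_le_of_forall_le _ _ fun S _ => ?_
  have h₁ : (∏ i ∈ S, (Polynomial.C (X (Sum.inl i) : MvPolynomial (Fin n ⊕ Fin n) ℝ) *
      Polynomial.X)).natDegree ≤ ∑ i ∈ S, 1 :=
    (Polynomial.natDegree_prod_le _ _).trans
      (Finset.sum_le_sum fun i _ =>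
        (Polynomial.natDegree_C_mul_le _ _).trans Polynomial.natDegree_X_le)
  have h₂ : (∏ i ∈ Sᶜ, (1 - Polynomial.C (1 - X (Sum.inr i) : MvPolynomial (Fin n ⊕ Fin n) ℝ) *
      Polynomial.X)).natDegree ≤ ∑ i ∈ Sᶜ, 1 :=
    (Polynomial.natDegree_prod_le _ _).trans (Finset.sum_le_sum fun i _ =>
      (Polynomial.natDegree_sub_le _ _).trans <| max_le (by simp) <|
        (Polynomial.natDegree_C_mul_le _ _).trans Polynomial.natDegree_X_le)
  have h₃ : S.card + Sᶜ.card = n := by simp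
  rw [Finset.sum_const, smul_eq_mul, mul_one] at h₁ h₂
  refine Polynomial.natDegree_mul_le.trans ?_
  have := (Polynomial.natDegree_C_mul_le (C (P (assignment S)) : MvPolynomial (Fin n ⊕ Fin n) ℝ)
    (∏ i ∈ S, (Polynomial.C (X (Sum.inl i)) * Polynomial.X)))
  omega

/-- Clearing the denominators in `g(x_1 t / (1 - y_1 t), …, x_n t / (1 - y_n t))`, where
`y_i = 1 - x̄_i`. -/
theorem prod_mul_eval₂_generatingPoly {n : ℕ} (P : (Fin n → Fin 2) → ℝ) :
    (∏ i : Fin n, (1 - PowerSeries.C (1 - X (Sum.inr i)) * PowerSeries.X)) *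
      eval₂ ((PowerSeries.C : MvPolynomial (Fin n ⊕ Fin n) ℝ →+* _).comp C)
        (fun i => mulGeomSeries (X (Sum.inl i)) (1 - X (Sum.inr i))) (generatingPoly P) =
      (shiftedNetworkPoly P : PowerSeries (MvPolynomial (Fin n ⊕ Fin n) ℝ)) := by
  have hcoe : (shiftedNetworkPoly P : PowerSeries (MvPolynomial (Fin n ⊕ Fin n) ℝ)) =
      ∑ S : Finset (Fin n), PowerSeries.C (C (P (assignment S))) *
        (∏ i ∈ S, (PowerSeries.C (X (Sum.inl i)) * PowerSeries.X)) *
        ∏ i ∈ Sᶜ, (1 - PowerSeries.C (1 - X (Sum.inr i)) * PowerSeries.X) := by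
    rw [← Polynomial.coeToPowerSeries.ringHom_apply, shiftedNetworkPoly]
    simp only [map_sum, map_mul, map_prod, map_sub, map_one,
      Polynomial.coeToPowerSeries.ringHom_apply, Polynomial.coe_C, Polynomial.coe_X]
  rw [hcoe, generatingPoly, ← coe_eval₂Hom, map_sum, Finset.mul_sum]
  refine Finset.sum_congr rfl fun S _ => ?_
  rw [map_mul, map_prod, coe_eval₂Hom, eval₂_C]
  simp only [eval₂_X]
  -- The factors `1 - y_i t` with `i ∈ S` cancel the denominators of the monomial of `S`; those with
  -- `i ∉ S` remain.
  rw [← Finset.prod_mul_prod_compl S, RingHom.comp_apply]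
  rw [← Finset.prod_congr rfl fun i _ => one_sub_mul_mulGeomSeries _ _, Finset.prod_mul_distrib]
  ring

/-- The five summands pay for the `y_i`, the series `x_i t / (1 - y_i t)`, the evaluation of `Φ`,
the multiplication by `∏ (1 - y_i t)`, and the sum of the coefficients. -/
theorem derives_networkPoly {n : ℕ} (P : (Fin n → Fin 2) → ℝ) (Φ : ArithCircuit (Fin n))
    (hΦ : Φ.poly = generatingPoly P) :
    Derives ∅ (n * 2 + n * (n * 2) + Φ.size * (3 * (n + 1) ^ 2) + n * ((n + 1) * 4) + (n + 1))
      {networkPoly P} := by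
  let x : Fin n → MvPolynomial (Fin n ⊕ Fin n) ℝ := fun i => X (Sum.inl i)
  let y : Fin n → MvPolynomial (Fin n ⊕ Fin n) ℝ := fun i => 1 - X (Sum.inr i)
  let z := fun i => mulGeomSeries (x i) (y i)
  have hxy : Derives ∅ (n * 2) (⋃ i ∈ (Finset.univ : Finset (Fin n)), {x i, y i}) := by
    have := Derives.biUnion (A := ∅) (Finset.univ : Finset (Fin n)) (d := fun _ => 2)
      (T := fun i => {x i, y i}) fun i _ => by
        refine (((Derives.C 1).trans ((Derives.X (Sum.inr i)).trans
          (Derives.X (Sum.inl i)))).trans (Derives.sub (p := C 1) (q := X (Sum.inr i))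
            (by simp) (by simp))).mono subset_rfl le_rfl ?_
        rintro p (rfl | rfl)
        · simp [x]
        · simp [y]
    simpa using this
  set A₁ : Set (MvPolynomial (Fin n ⊕ Fin n) ℝ) :=
    ⋃ i ∈ (Finset.univ : Finset (Fin n)), {x i, y i} with hA₁
  have hx : ∀ i, x i ∈ A₁ := fun i =>
    Set.mem_biUnion (Finset.mem_coe.2 (Finset.mem_univ i)) (by simp)
  have hy : ∀ i, y i ∈ A₁ := fun i =>
    Set.mem_biUnion (Finset.mem_coe.2 (Finset.mem_univ i)) (by simp)
  have hz : Derives (∅ ∪ A₁) (n * (n * 2)) (⋃ i, coeffsUpTo n (z i)) := by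
    have := Derives.biUnion (A := ∅ ∪ A₁) (Finset.univ : Finset (Fin n)) (d := fun _ => n * 2)
      (T := fun i => coeffsUpTo n (z i)) fun i _ =>
        Derives.coeffsUpTo_mulGeomSeries (Or.inr (hx i)) (Or.inr (hy i)) n
    simpa using this
  have h₃ := (hxy.trans hz).trans
    ((Φ.derives_coeffsUpTo n z).mono (fun p hp => Or.inr (Or.inr hp)) le_rfl subset_rfl)
  have h₄ := h₃.trans (Derives.coeffsUpTo_prod_one_sub_mul (y := y) (n := n) Finset.univ
    (fun i _ => Or.inr (Or.inl (Or.inl (hy i)))) (fun p hp => Or.inr (Or.inr hp)))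
  rw [Finset.card_univ, Fintype.card_fin, hΦ] at h₄
  have hnet : networkPoly P = ∑ k ∈ Finset.range (n + 1), PowerSeries.coeff k
      ((∏ i : Fin n, (1 - PowerSeries.C (y i) * PowerSeries.X)) *
        eval₂ ((PowerSeries.C : MvPolynomial (Fin n ⊕ Fin n) ℝ →+* _).comp C) z
          (generatingPoly P)) := by
    rw [← eval_one_shiftedNetworkPoly, Polynomial.eval_eq_sum_range'
      (Nat.lt_succ_of_le (natDegree_shiftedNetworkPoly_le P))]
    refine Finset.sum_congr rfl fun k _ => ?_
    rw [prod_mul_eval₂_generatingPoly, Polynomial.coeff_coe, one_pow, mul_one]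
  rw [hnet]
  refine (h₄.trans (Derives.finset_sum (Finset.range (n + 1)) _ fun k hk => ?_)).mono subset_rfl
    (by rw [Finset.card_range]) Set.subset_union_right
  exact Or.inr (Or.inr (coeff_mem_coeffsUpTo _ (Nat.lt_succ_iff.1 (Finset.mem_range.1 hk))))

end Network

/-- A circuit of size `s` computing the generating polynomial of a distribution on `n` binary
variables can be transformed into a circuit of size `O(s n²)` computing its network polynomial.
The constant is absolute. A circuit without edges (a single leaf) is counted as having size `1`
in the bound. -/
theorem mainTheorem1 :
    ∃ K : ℕ, ∀ (n : ℕ) (P : (Fin n → Fin 2) → ℝ), IsProbabilityMass P →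
      ∀ Φ : ArithCircuit (Fin n), Φ.poly = generatingPoly P →
        ∃ Ψ : ArithCircuit (Fin n ⊕ Fin n),
          Ψ.poly = networkPoly P ∧ Ψ.size ≤ K * (max Φ.size 1 * n ^ 2) := by
  -- For `n ≥ 1`, `3 (n + 1)² ≤ 12 n²` bounds the cost per edge of `Φ`, and the other terms add up
  -- to `6 n² + 7 n + 1 ≤ 14 n²`; `12 + 14 = 26`.
  refine ⟨26, fun n P _ Φ hΦ => ?_⟩
  -- For `n = 0` the bound is `0`, so no edge is allowed; `p` is then a constant, given by a single
  -- leaf.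
  rcases Nat.eq_zero_or_pos n with rfl | hn
  · obtain ⟨Ψ, h₁, h₂⟩ := (Derives.C (A := ∅) (P (assignment ∅))).exists_circuit
      (Set.mem_singleton (MvPolynomial.C (P (assignment ∅)) : MvPolynomial (Fin 0 ⊕ Fin 0) ℝ))
    refine ⟨Ψ, h₁.trans ?_, h₂.trans (Nat.zero_le _)⟩
    simp [networkPoly, Finset.univ_unique, Subsingleton.elim (default : Finset (Fin 0)) ∅]
  · obtain ⟨Ψ, h₁, h₂⟩ := (derives_networkPoly P Φ hΦ).exists_circuit (Set.mem_singleton _)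
    refine ⟨Ψ, h₁, h₂.trans ?_⟩
    have hs : Φ.size ≤ max Φ.size 1 := le_max_left _ _
    have hm : 1 ≤ max Φ.size 1 := le_max_right _ _
    generalize max Φ.size 1 = m at hs hm ⊢
    have e₁ : Φ.size * (3 * (n + 1) ^ 2) ≤ m * (12 * n ^ 2) :=
      Nat.mul_le_mul hs (by nlinarith)
    have e₂ : n ^ 2 ≤ m * n ^ 2 := Nat.le_mul_of_pos_left _ hm
    nlinarith
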